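/- **Theorem (Asymptotic radius of Bayesian credible regions).** Let $\alpha\in(0,\tfrac12)$. For $S\ge 2$ put $$\kappa_S=\frac{\sqrt{\chi^2_{S-1,1-\alpha}}}{\Phi^{-1}(1-\alpha)},$$ where $\chi^2_{S-1,1-\alpha}$ and $\Phi^{-1}(1-\alpha)$ are the $(1-\alpha)$-quantiles of the chi-squared distribution with $S-1$ degrees of freedom and of the standard normal distribution. *Setting.* Let there be $S\ge 2$ states and $A$ actions, let $\Delta^S\subset\mathbb R^S$ be the probability simplex, and let $p^*_{s,a}\in\Delta^S$ be the true transition probabilities. For each $N\in\mathbb N$ let $\tilde P^N=(\tilde p^N_{s,a})_{s,a}$ be random transition probabilities with values in $\Delta^S$, distributed according to the posterior after $N$ observations. Assume that the posterior is asymptotically normal: for all $s,a$, $$\sqrt N(\tilde p^N_{s,a}-p^*_{s,a})\rightsquigarrow\mathcal N(0,\Sigma_{s,a})\qquad(N\to\infty)$$ in distribution, where $\Sigma_{s,a}$ (the inverse Fisher information) is a positive semidefinite $S\times S$ matrix of rank $S-1$. *VaR ambiguity sets.* With $\mathrm{VaR}_\alpha[X]=\sup\{t:\Pr[X\ge t]\ge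 1-\alpha\}$ let $$\mathcal P^{\mathrm{VaR},N}_{s,a}=\bigcap_{v\in\mathbb R^S}\bigl\{p\in\Delta^S : p^\top v\ge \mathrm{VaR}_\alpha[(\tilde p^N_{s,a})^\top v]\bigr\}.$$ *Credible regions.* A Bayesian credible region is a set $\mathcal P^{\mathrm{BCR},N}_{s,a}\subseteq\Delta^S$ with $\Pr[\tilde p^N_{s,a}\in\mathcal P^{\mathrm{BCR},N}_{s,a}]\ge 1-\alpha$. Limits of sequences of sets are Painlevé–Kuratowski limits; $\operatorname{Ls}$ denotes the outer limit, which is the limit whenever the latter exists. *Conclusion.* There are constants $c>0$ and $c'$ that depend only on $\alpha$ such that the following holds. 1. $c\sqrt S\le\kappa_S\le c'\sqrt S$ for all $S\ge 2$. 2. In every such setting and for all $s,a$, the limit $V_\xi=\lim_{N\to\infty}\sqrt N\,\xi\,(\mathcal P^{\mathrm{VaR},N}_{s,a}-p^*_{s,a})$ exists for every real $\xi$, and for every sequence of Bayesian credible regions $\mathcal P^{\mathrm{BCR},N}_{s,a}$ and every real $\xi$ with $|\xi|<\kappa_S$, $$\operatorname{Ls}_{N\to\infty}\sqrt N(\mathcal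 P^{\mathrm{BCR},N}_{s,a}-p^*_{s,a})\not\subseteq V_\xi;$$ in particular $\lim_{N\to\infty}\sqrt N(\mathcal P^{\mathrm{BCR},N}_{s,a}-p^*_{s,a})\not\subseteq V_\xi$ whenever this limit exists. 3. In the situation of 2 there are a direction $u\neq 0$ and $t>0$ with $tu\in\operatorname{Ls}_{N\to\infty}\sqrt N(\mathcal P^{\mathrm{BCR},N}_{s,a}-p^*_{s,a})$ such that $c\sqrt S\,r<t$ for every $r\ge 0$ with $ru\in V_1$. That is, in the direction $u$ the scaled limit of the credible regions reaches more than $c\sqrt S$ times as far as that of the VaR ambiguity sets. -/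

import Mathlib

open MeasureTheory ProbabilityTheory Filter Topology
open scoped Pointwise

noncomputable section

namespace CredibleRadius

/-- The space `ℝ^S` in which the transition probability vectors live. -/
abbrev Vec (S : ℕ) : Type := EuclideanSpace ℝ (Fin S)

/-- A family `(p_{s,a})` of vectors of `ℝ^S`, one for each state `s` and action `a`. -/
abbrev Model (S A : ℕ) : Type := Fin S → Fin A → Vec S

/-- The probability simplex `Δ^S`. -/
def simplex (S : ℕ) : Set (Vec S) :=
  {p | (∀ i, 0 ≤ p i) ∧ ∑ i, p i = 1}

/-- The (lower) quantile function of a probability measure on `ℝ`. -/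
def quantile (μ : Measure ℝ) (q : ℝ) : ℝ :=
  sInf {x : ℝ | q ≤ cdf μ x}

/-- The chi-squared distribution with `k` degrees of freedom: the law of the sum of the squares of
`k` independent standard normal variables. -/
def chiSquared (k : ℕ) : Measure ℝ :=
  (Measure.pi (fun _ : Fin k => gaussianReal 0 1)).map (fun x => ∑ i, x i ^ 2)

/-- `√(χ²_{S-1,1-α}) / Φ⁻¹(1-α)`. -/
def radiusRatio (S : ℕ) (α : ℝ) : ℝ :=
  √(quantile (chiSquared (S - 1)) (1 - α)) / quantile (gaussianReal 0 1) (1 - α)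

/-- `VaR_α[X] = sup {t : Pr[X ≥ t] ≥ 1 - α}`. -/
def valueAtRisk {Ω : Type*} [MeasurableSpace Ω] (μ : Measure Ω) (α : ℝ) (X : Ω → ℝ) : ℝ :=
  sSup {t : ℝ | 1 - α ≤ μ.real {ω | t ≤ X ω}}

/-- The VaR ambiguity set for the value function `v`: the `p ∈ Δ^S` with
`pᵀ v ≥ VaR_α[p̃_{s,a}ᵀ v]`, where `p̃` has law `μ`. -/
def varSetAt {S A : ℕ} (μ : Measure (Model S A)) (α : ℝ) (s : Fin S) (a : Fin A) (v : Vec S) :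
    Set (Vec S) :=
  {p | p ∈ simplex S ∧ valueAtRisk μ α (fun P => inner ℝ (P s a) v) ≤ inner ℝ p v}

/-- The VaR ambiguity set that does not depend on the value function: the intersection of the sets
`varSetAt` over all value functions `v`. -/
def varSet {S A : ℕ} (μ : Measure (Model S A)) (α : ℝ) (s : Fin S) (a : Fin A) : Set (Vec S) :=
  ⋂ v : Vec S, varSetAt μ α s a v

/-- `C ⊆ Δ^S` is a Bayesian credible region for `p̃_{s,a}` at confidence level `1 - α`. -/
def IsCredibleRegion {S A : ℕ} (μ : Measure (Model S A)) (α : ℝ) (s : Fin S) (a : Fin A)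
    (C : Set (Vec S)) : Prop :=
  C ⊆ simplex S ∧ 1 - α ≤ μ.real {P | P s a ∈ C}

/-- Asymptotic normality of the posterior: for all `s, a`, if `P` has law `post N`, then
`√N (P_{s,a} - p*_{s,a})` converges in distribution, as `N → ∞`, to the centered normal law with
covariance matrix `cov s a`. This matrix is degenerate (the entries of a transition vector
sum to one), but it has the largest possible rank `S - 1`. -/
def AsymptoticallyNormal {S A : ℕ} (post : ℕ → Measure (Model S A))
    [∀ N, IsProbabilityMeasure (post N)] (pstar : Model S A)
    (cov : Fin S → Fin A → Matrix (Fin S) (Fin S) ℝ) : Prop :=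
  ∀ s a, (cov s a).PosSemidef ∧ (cov s a).rank = S - 1 ∧
    TendstoInDistribution (fun (N : ℕ) (P : Model S A) => √(N : ℝ) • (P s a - pstar s a)) atTop id
      post (multivariateGaussian 0 (cov s a))

/-- Outer (upper) limit of a sequence of sets, in the sense of Painlevé and Kuratowski. -/
def outerLim {E : Type*} [TopologicalSpace E] (C : ℕ → Set E) : Set E :=
  {x | ∀ U ∈ 𝓝 x, ∃ᶠ N in atTop, (C N ∩ U).Nonempty}

/-- Inner (lower) limit of a sequence of sets, in the sense of Painlevé and Kuratowski. -/
def innerLim {E : Type*} [TopologicalSpace E] (C : ℕ → Set E) : Set E :=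
  {x | ∀ U ∈ 𝓝 x, ∀ᶠ N in atTop, (C N ∩ U).Nonempty}

/-- `C N` converges to the set `L` as `N → ∞`: inner and outer limit are both equal to `L`. -/
def SetTendsto {E : Type*} [TopologicalSpace E] (C : ℕ → Set E) (L : Set E) : Prop :=
  innerLim C = L ∧ outerLim C = L

/-- `√N ξ (C_N - x)`. -/
def scaled {S : ℕ} (ξ : ℝ) (C : ℕ → Set (Vec S)) (x : Vec S) (N : ℕ) : Set (Vec S) :=
  (fun p => (√(N : ℝ) * ξ) • (p - x)) '' C N

end CredibleRadius

end

noncomputable section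

namespace CredibleRadius

/-! Let `T` be the square root of the limit covariance and `z` the normal quantile at `1 - α`. In
direction `v` the scaled posterior is asymptotically `‖T v‖` times a standard normal variable, so
its VaR tends to `-z ‖T v‖`. These half-space constraints cut out the `T`-image of the ball of
radius `z`; hence `V ξ` is `ellipsoid T (|ξ| * z)` (`setTendsto_scaled_varSet`).

A half-space sees one normal variable, whereas the mass of an ellipsoid involves all `S - 1`
nondegenerate directions: it is at most the chi-squared cdf at `(ξ z)²` (`real_ellipsoid_le`), which
is below `1 - α` for `|ξ| < κ_S`. The outer limit of credible regions keeps mass at least `1 - α`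
(`le_real_outerLim`), so it cannot fit inside. Markov's inequality, applied once to the sum of
squares and once to the number of small coordinates, bounds the chi-squared quantile linearly in `S`
from both sides (`exists_radiusRatio_bounds`). -/

lemma exists_measureReal_lt_of_iInter {E : Type*} [MeasurableSpace E] {μ : Measure E}
    [IsFiniteMeasure μ] {F : ℕ → Set E} (hF : ∀ n, MeasurableSet (F n)) (hanti : Antitone F)
    {q : ℝ} (hq : μ.real (⋂ n, F n) < q) : ∃ n, μ.real (F n) < q := by
  have h := tendsto_measure_iInter_atTop (μ := μ) (fun n => (hF n).nullMeasurableSet) hanti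
    ⟨0, measure_ne_top _ _⟩
  have h' := (ENNReal.tendsto_toReal (measure_ne_top μ _)).comp h
  exact (h'.eventually_lt_const hq).exists

/-! ### Quantiles and distribution functions. -/

section Quantile

variable {μ : Measure ℝ} {q x : ℝ}

lemma bddBelow_le_cdf (hq : 0 < q) : BddBelow {x : ℝ | q ≤ cdf μ x} := by
  obtain ⟨b, hb⟩ := ((tendsto_cdf_atBot μ).eventually_lt_const hq).exists
  refine ⟨b, fun y hy => ?_⟩
  by_contra! h
  exact absurd (hy.trans (monotone_cdf μ h.le)) (not_le.2 hb)

lemma nonempty_le_cdf (hq : q < 1) : {x : ℝ | q ≤ cdf μ x}.Nonempty := by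
  obtain ⟨b, hb⟩ := ((tendsto_cdf_atTop μ).eventually_const_lt hq).exists
  exact ⟨b, hb.le⟩

lemma cdf_lt_of_lt_quantile (hq : 0 < q) (hx : x < quantile μ q) : cdf μ x < q := by
  by_contra! h
  exact absurd (csInf_le (bddBelow_le_cdf hq) h) (not_le.2 hx)

lemma quantile_le (hq : 0 < q) (hx : q ≤ cdf μ x) : quantile μ q ≤ x :=
  csInf_le (bddBelow_le_cdf hq) hx

lemma le_quantile (hq : q < 1) (hx : cdf μ x < q) : x ≤ quantile μ q := by
  refine le_csInf (nonempty_le_cdf hq) fun y hy => ?_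
  by_contra! h
  exact absurd (hy.trans (monotone_cdf μ h.le)) (not_le.2 hx)

lemma le_cdf_of_quantile_lt (hq : q < 1) (hx : quantile μ q < x) : q ≤ cdf μ x := by
  obtain ⟨y, hy, hyx⟩ := exists_lt_of_csInf_lt (nonempty_le_cdf hq) hx
  exact le_trans hy (monotone_cdf μ hyx.le)

/-- Right continuity keeps the cdf below `q` slightly to the right of `x`. -/
lemma lt_quantile (hq : q < 1) (hx : cdf μ x < q) : x < quantile μ q := by
  have h := ((cdf μ).right_continuous x).tendsto.mono_left
    (nhdsWithin_mono x Set.Ioi_subset_Ici_self)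
  obtain ⟨y, hy, hxy⟩ := ((h.eventually_lt_const hx).and self_mem_nhdsWithin).exists
  exact lt_of_lt_of_le hxy (le_quantile hq hy)

end Quantile

/-! ### The standard normal distribution. -/

section StandardNormal

lemma cdf_gaussianReal_strictMono : StrictMono (cdf (gaussianReal 0 1)) := by
  intro x y hxy
  refine lt_of_le_of_ne (monotone_cdf _ hxy.le) fun h => ?_
  have h0 : (gaussianReal 0 1) (Set.Ioc x y) = 0 := by
    rw [← measure_cdf (gaussianReal 0 1), StieltjesFunction.measure_Ioc, h]
    simp
  have := gaussianReal_absolutelyContinuous' 0 one_ne_zero h0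
  rw [Real.volume_Ioc, ENNReal.ofReal_eq_zero] at this
  linarith

lemma gaussianReal_real_Ici_neg (x : ℝ) :
    (gaussianReal 0 1).real (Set.Ici (-x)) = cdf (gaussianReal 0 1) x := by
  rw [cdf_eq_real]
  have : (gaussianReal 0 1).map (fun y => -y) = gaussianReal 0 1 := by
    simpa using gaussianReal_map_neg (μ := 0) (v := 1)
  conv_rhs => rw [← this]
  rw [map_measureReal_apply measurable_neg measurableSet_Iic]
  congr 1
  ext y
  simp

lemma cdf_gaussianReal_zero : cdf (gaussianReal 0 1) 0 = 1 / 2 := by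
  have h1 := gaussianReal_real_Ici_neg 0
  rw [neg_zero] at h1
  have h2 : (gaussianReal 0 1).real (Set.Ici 0) = (gaussianReal 0 1).real (Set.Iic 0)ᶜ := by
    have := nullSingletonClass_gaussianReal (μ := 0) (v := 1) one_ne_zero
    rw [Set.compl_Iic]
    exact measureReal_congr Ioi_ae_eq_Ici.symm
  rw [probReal_compl_eq_one_sub measurableSet_Iic, ← cdf_eq_real] at h2
  linarith

lemma quantile_gaussianReal_pos {α : ℝ} (hα : α ∈ Set.Ioo (0 : ℝ) (1 / 2)) :
    0 < quantile (gaussianReal 0 1) (1 - α) := by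
  refine lt_quantile (by linarith [hα.1]) ?_
  rw [cdf_gaussianReal_zero]
  linarith [hα.2]

lemma lt_cdf_gaussianReal {q x : ℝ} (hq : q < 1) (hx : quantile (gaussianReal 0 1) q < x) :
    q < cdf (gaussianReal 0 1) x := by
  obtain ⟨y, hy, hyx⟩ := exists_between hx
  exact (le_cdf_of_quantile_lt hq hy).trans_lt (cdf_gaussianReal_strictMono hyx)

end StandardNormal

/-! ### Growth of chi-squared quantiles. -/

section ChiSquared

instance isProbabilityMeasure_chiSquared (k : ℕ) : IsProbabilityMeasure (chiSquared k) :=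
  Measure.isProbabilityMeasure_map (Measurable.aemeasurable (by fun_prop))

lemma cdf_chiSquared (k : ℕ) (x : ℝ) :
    cdf (chiSquared k) x =
      (Measure.pi (fun _ : Fin k => gaussianReal 0 1)).real {y | ∑ i, y i ^ 2 ≤ x} := by
  rw [cdf_eq_real, chiSquared, map_measureReal_apply (by fun_prop) measurableSet_Iic]
  rfl

lemma integral_sq_gaussianReal : ∫ x, x ^ 2 ∂(gaussianReal 0 1) = 1 := by
  have h := variance_id_gaussianReal (μ := 0) (v := 1)
  rw [variance_of_integral_eq_zero (by fun_prop) (by simp)] at h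
  simpa using h

/-- Markov's inequality for the sum of squares, whose mean is `k`. -/
lemma one_sub_le_cdf_chiSquared {α : ℝ} (hα : 0 < α) (k : ℕ) (hk : 0 < k) :
    1 - α ≤ cdf (chiSquared k) (k / α) := by
  have hint : ∀ i : Fin k, Integrable (fun y : Fin k → ℝ => y i ^ 2)
      (Measure.pi (fun _ : Fin k => gaussianReal 0 1)) := fun i =>
    integrable_comp_eval (μ := fun _ : Fin k => gaussianReal 0 1) (f := fun x => x ^ 2)
      (IsGaussian.memLp_two_id (μ := gaussianReal 0 1)).integrable_sq
  have hval : ∫ y : Fin k → ℝ, ∑ i, y i ^ 2 ∂(Measure.pi (fun _ : Fin k => gaussianReal 0 1))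
      = k := by
    rw [integral_finsetSum _ fun i _ => hint i]
    have : ∀ i : Fin k, ∫ y : Fin k → ℝ, y i ^ 2
        ∂(Measure.pi (fun _ : Fin k => gaussianReal 0 1)) = 1 := fun i => by
      rw [integral_comp_eval (μ := fun _ : Fin k => gaussianReal 0 1) (f := fun x => x ^ 2)
        (by fun_prop), integral_sq_gaussianReal]
    simp [this]
  have hm := mul_meas_ge_le_integral_of_nonneg
    (μ := Measure.pi (fun _ : Fin k => gaussianReal 0 1)) (f := fun y => ∑ i, y i ^ 2)
    (ae_of_all _ fun y => Finset.sum_nonneg fun i _ => sq_nonneg (y i))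
    (integrable_finsetSum _ fun i _ => hint i) (k / α)
  rw [hval] at hm
  have hk' : (0 : ℝ) < k := by exact_mod_cast hk
  have hge : (Measure.pi (fun _ : Fin k => gaussianReal 0 1)).real
      {y | k / α ≤ ∑ i, y i ^ 2} ≤ α := by
    rw [div_mul_eq_mul_div, div_le_iff₀ hα] at hm
    exact le_of_mul_le_mul_left hm hk'
  rw [cdf_chiSquared]
  have hc := probReal_compl_eq_one_sub (μ := Measure.pi (fun _ : Fin k => gaussianReal 0 1))
    (s := {y | ∑ i, y i ^ 2 ≤ k / α}) (measurableSet_le (by fun_prop) (by fun_prop))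
  have hsub : (Measure.pi (fun _ : Fin k => gaussianReal 0 1)).real
      {y | ∑ i, y i ^ 2 ≤ k / α}ᶜ ≤ α :=
    by
    have hss : {y : Fin k → ℝ | ∑ i, y i ^ 2 ≤ k / α}ᶜ ⊆ {y | k / α ≤ ∑ i, y i ^ 2} := by
      intro y hy
      simp only [Set.mem_compl_iff, Set.mem_ofPred_eq, not_le] at hy
      exact hy.le
    exact (measureReal_mono hss).trans hge
  linarith

/-- Few coordinates of a standard normal vector can be small. -/
lemma cdf_chiSquared_le {c : ℝ} (hc : 0 < c) (k : ℕ) (hk : 0 < k) :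
    cdf (chiSquared k) (c * k) ≤ 2 * (gaussianReal 0 1).real {x | x ^ 2 ≤ 2 * c} := by
  set p := (gaussianReal 0 1).real {x | x ^ 2 ≤ 2 * c} with hp
  set μ := Measure.pi (fun _ : Fin k => gaussianReal 0 1) with hμ
  have hk' : (0 : ℝ) < k := by exact_mod_cast hk
  set φ : ℝ → ℝ := Set.indicator {x | x ^ 2 ≤ 2 * c} 1 with hφ
  have hms : MeasurableSet {x : ℝ | x ^ 2 ≤ 2 * c} :=
    measurableSet_le (by fun_prop) (by fun_prop)
  have hφi : Integrable φ (gaussianReal 0 1) := (integrable_const 1).indicator hms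
  have hint : ∀ i : Fin k, Integrable (fun y : Fin k → ℝ => φ (y i)) μ := fun i =>
    integrable_comp_eval (μ := fun _ : Fin k => gaussianReal 0 1) hφi
  have hφ0 : ∀ x, 0 ≤ φ x := fun x => Set.indicator_nonneg (fun _ _ => zero_le_one) x
  have hval : ∫ y : Fin k → ℝ, ∑ i, φ (y i) ∂μ = k * p := by
    rw [integral_finsetSum _ fun i _ => hint i]
    have : ∀ i : Fin k, ∫ y : Fin k → ℝ, φ (y i) ∂μ = p := fun i => by
      rw [integral_comp_eval (μ := fun _ : Fin k => gaussianReal 0 1) (f := φ)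
        hφi.aestronglyMeasurable, hφ, integral_indicator_one hms]
    simp [this]
  have hm := mul_meas_ge_le_integral_of_nonneg (μ := μ) (f := fun y => ∑ i, φ (y i))
    (ae_of_all _ fun y => Finset.sum_nonneg fun i _ => hφ0 (y i))
    (integrable_finsetSum _ fun i _ => hint i) (k / 2)
  rw [hval] at hm
  have hge : μ.real {y | k / 2 ≤ ∑ i, φ (y i)} ≤ 2 * p := by
    refine le_of_mul_le_mul_left (a := (k : ℝ) / 2) ?_ (by positivity)
    calc _ ≤ k * p := hm
      _ = _ := by ring
  rw [cdf_chiSquared]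
  have hss : {y : Fin k → ℝ | ∑ i, y i ^ 2 ≤ c * k} ⊆ {y | k / 2 ≤ ∑ i, φ (y i)} := by
    intro y hy
    -- Each coordinate with square above `2 * c` uses up more than `2 * c` of the budget `c * k`, so
    -- at most half of the coordinates are of this kind.
    have hpt : ∀ i, 2 * c * (1 - φ (y i)) ≤ y i ^ 2 := fun i => by
      by_cases h : y i ^ 2 ≤ 2 * c
      · have : φ (y i) = 1 := Set.indicator_of_mem (s := {x : ℝ | x ^ 2 ≤ 2 * c}) h 1
        rw [this]
        nlinarith [sq_nonneg (y i)]
      · have : φ (y i) = 0 := Set.indicator_of_notMem (s := {x : ℝ | x ^ 2 ≤ 2 * c}) h 1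
        rw [this]
        linarith
    have hsum := (Finset.sum_le_sum fun i (_ : i ∈ Finset.univ) => hpt i).trans hy
    rw [← Finset.mul_sum, Finset.sum_sub_distrib] at hsum
    simp only [Finset.sum_const, Finset.card_univ, Fintype.card_fin, nsmul_eq_mul, mul_one] at hsum
    have : 2 * ((k : ℝ) - ∑ i, φ (y i)) ≤ k :=
      le_of_mul_le_mul_left (a := c) (by linarith) hc
    change (k : ℝ) / 2 ≤ ∑ i, φ (y i)
    linarith
  exact (measureReal_mono hss).trans hge

/-- The sets `{x ^ 2 ≤ 2 * c}` shrink to a null set as `c` decreases to `0`, so one `c` brings their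
mass below `1 / 4`, independently of `k`. -/
lemma exists_cdf_chiSquared_le_half :
    ∃ c : ℝ, 0 < c ∧ ∀ k : ℕ, 0 < k → cdf (chiSquared k) (c * k) ≤ 1 / 2 := by
  have hI : (gaussianReal 0 1).real (⋂ n : ℕ, {x : ℝ | x ^ 2 ≤ 2 * (1 / ((n : ℝ) + 1))}) < 1 / 4 := by
    have : (⋂ n : ℕ, {x : ℝ | x ^ 2 ≤ 2 * (1 / ((n : ℝ) + 1))}) ⊆ {0} := by
      intro x hx
      simp only [Set.mem_iInter, Set.mem_ofPred_eq] at hx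
      have ht : Tendsto (fun n : ℕ => 2 * (1 / ((n : ℝ) + 1))) atTop (𝓝 (2 * 0)) :=
        tendsto_one_div_add_atTop_nhds_zero_nat.const_mul 2
      have := ge_of_tendsto' ht hx
      have h0 : x ^ 2 = 0 := le_antisymm (by linarith) (sq_nonneg x)
      simpa using h0
    refine (measureReal_mono this).trans_lt ?_
    have := nullSingletonClass_gaussianReal (μ := 0) (v := 1) one_ne_zero
    rw [measureReal_def, measure_singleton]
    norm_num
  obtain ⟨n, hn⟩ := exists_measureReal_lt_of_iInter (fun n => measurableSet_le (by fun_prop)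
    (by fun_prop)) (fun m n hmn x (hx : x ^ 2 ≤ _) => hx.trans (by gcongr)) hI
  refine ⟨1 / ((n : ℝ) + 1), by positivity, fun k hk => ?_⟩
  linarith [cdf_chiSquared_le (c := 1 / ((n : ℝ) + 1)) (by positivity) k hk]

/-- The ratio of the two radii grows like `√S`. -/
lemma exists_radiusRatio_bounds {α : ℝ} (hα : α ∈ Set.Ioo (0 : ℝ) (1 / 2)) :
    ∃ c c' : ℝ, 0 < c ∧ ∀ S : ℕ, 2 ≤ S →
      c * √(S : ℝ) < radiusRatio S α ∧ radiusRatio S α ≤ c' * √(S : ℝ) := by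
  obtain ⟨b, hb, hbk⟩ := exists_cdf_chiSquared_le_half
  set z := quantile (gaussianReal 0 1) (1 - α) with hz
  have hz0 : 0 < z := quantile_gaussianReal_pos hα
  have hα0 := hα.1
  have hα2 := hα.2
  -- `b * (S - 1) ≥ b * S / 2` would give a weak lower bound; `b / 4` makes it strict. The upper
  -- constant comes from `(S - 1) / α ≤ S / α`.
  refine ⟨√(b / 4) / z, √(1 / α) / z, by positivity, fun S hS => ?_⟩
  have hS1 : 0 < S - 1 := by omega
  have hcast : ((S - 1 : ℕ) : ℝ) = S - 1 := by
    rw [Nat.cast_sub (by omega)]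
    simp
  have hS2 : (2 : ℝ) ≤ S := by exact_mod_cast hS
  rw [radiusRatio, ← hz, div_mul_eq_mul_div, div_mul_eq_mul_div, ← Real.sqrt_mul (by positivity),
    ← Real.sqrt_mul (by positivity)]
  constructor
  · refine div_lt_div_of_pos_right (Real.sqrt_lt_sqrt (by positivity) ?_) hz0
    have h := le_quantile (q := 1 - α) (by linarith) ((hbk (S - 1) hS1).trans_lt (by linarith))
    rw [hcast] at h
    nlinarith
  · refine div_le_div_of_nonneg_right (Real.sqrt_le_sqrt ?_) hz0.le
    have h := quantile_le (by linarith) (one_sub_le_cdf_chiSquared hα0 (S - 1) hS1)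
    rw [hcast] at h
    refine h.trans ?_
    rw [one_div, inv_mul_eq_div]
    gcongr
    linarith

end ChiSquared

/-! ### Ellipsoids given by their support functions. -/

section Ellipsoid

variable {E : Type*} [NormedAddCommGroup E] [InnerProductSpace ℝ E] {T : E →L[ℝ] E}

/-- The closed convex set whose support function is `v ↦ r ‖T v‖`. -/
def ellipsoid (T : E →L[ℝ] E) (r : ℝ) : Set E :=
  {x | ∀ v, -(r * ‖T v‖) ≤ inner ℝ x v}

lemma isClosed_ellipsoid (r : ℝ) : IsClosed (ellipsoid T r) := by
  simp only [ellipsoid, Set.ofPred_forall]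
  exact isClosed_iInter fun v => isClosed_le (by fun_prop) (by fun_prop)

lemma ellipsoid_mono {r r' : ℝ} (h : r ≤ r') : ellipsoid T r ⊆ ellipsoid T r' :=
  fun _ hx v => (neg_le_neg (mul_le_mul_of_nonneg_right h (norm_nonneg _))).trans (hx v)

lemma zero_mem_ellipsoid {r : ℝ} (h : 0 ≤ r) : (0 : E) ∈ ellipsoid T r := fun v => by
  rw [inner_zero_left]
  have := mul_nonneg h (norm_nonneg (T v))
  linarith

lemma smul_mem_ellipsoid {r : ℝ} {x : E} (hx : x ∈ ellipsoid T r) (ξ : ℝ) :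
    ξ • x ∈ ellipsoid T (|ξ| * r) := fun v => by
  have h := hx (ξ • v)
  rw [map_smul, norm_smul, Real.norm_eq_abs, inner_smul_right] at h
  rw [real_inner_smul_left]
  linarith

lemma exists_smul_eq_of_mem_ellipsoid {r : ℝ} (hr : 0 ≤ r) {x : E} {ξ : ℝ}
    (hx : x ∈ ellipsoid T (|ξ| * r)) : ∃ y ∈ ellipsoid T r, ξ • y = x := by
  rcases eq_or_ne ξ 0 with rfl | hξ
  -- The ellipsoid of radius `0` is a single point: testing with `-x` gives `‖x‖ ^ 2 ≤ 0`.
  · refine ⟨0, zero_mem_ellipsoid hr, ?_⟩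
    have h := hx (-x)
    rw [inner_neg_right, real_inner_self_eq_norm_sq] at h
    simp only [abs_zero, zero_mul, neg_zero] at h
    have : ‖x‖ = 0 := by nlinarith [norm_nonneg x]
    rw [norm_eq_zero.1 this, smul_zero]
  · refine ⟨ξ⁻¹ • x, ?_, smul_inv_smul₀ hξ x⟩
    have h := smul_mem_ellipsoid hx ξ⁻¹
    rwa [← mul_assoc, ← abs_mul, inv_mul_cancel₀ hξ, abs_one, one_mul] at h

/-- By self-adjointness the constraints on `T y` only pair `y` with the range of `T`. The one where
`T v` is minus the projection of `y` reads `‖proj y‖ ^ 2 ≤ r * ‖proj y‖`. -/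
lemma norm_orthogonalProjection_le_of_mem_ellipsoid [FiniteDimensional ℝ E]
    (hT : IsSelfAdjoint T) {r : ℝ} (hr : 0 ≤ r) {y : E} (hy : T y ∈ ellipsoid T r) :
    ‖(LinearMap.range (T : E →ₗ[ℝ] E)).orthogonalProjectionOnto y‖ ≤ r := by
  set W := LinearMap.range (T : E →ₗ[ℝ] E) with hW
  obtain ⟨v, hv⟩ : ∃ v, T v = -(W.orthogonalProjectionOnto y : E) :=
    W.neg_mem (W.orthogonalProjectionOnto y).2
  have h := hy v
  have hs : inner ℝ (T y) v = inner ℝ y (T v) := hT.isSymmetric y v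
  have hp : inner ℝ y (W.orthogonalProjectionOnto y : E) = ‖W.orthogonalProjectionOnto y‖ ^ 2 := by
    rw [← W.inner_orthogonalProjectionOnto_eq_of_mem_right, real_inner_self_eq_norm_sq]
  rw [hs, hv, inner_neg_right, norm_neg, hp, ← Submodule.coe_norm] at h
  rcases (norm_nonneg (W.orthogonalProjectionOnto y)).eq_or_lt with h0 | h0
  · rwa [← h0]
  · exact le_of_mul_le_mul_right (by linarith [sq ‖W.orthogonalProjectionOnto y‖]) h0

end Ellipsoid

/-! ### Gaussian mass of half-spaces and ellipsoids. -/

section Gaussian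

variable {E : Type*} [NormedAddCommGroup E] [InnerProductSpace ℝ E] [FiniteDimensional ℝ E]
  [MeasurableSpace E] [BorelSpace E]

lemma stdGaussian_map_orthogonalProjection (W : Submodule ℝ E) :
    (stdGaussian E).map W.orthogonalProjectionOnto = stdGaussian W := by
  apply Measure.ext_of_charFun
  ext t
  rw [charFun_stdGaussian, charFun_apply, integral_map (by fun_prop) (by fun_prop)]
  have : ∀ x, inner ℝ (W.orthogonalProjectionOnto x) t = inner ℝ x (t : E) := fun x =>
    W.inner_orthogonalProjectionOnto_eq_of_mem_right t x
  simp_rw [this]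
  rw [← charFun_apply, charFun_stdGaussian]
  simp

lemma stdGaussian_map_norm_sq :
    (stdGaussian E).map (fun x => ‖x‖ ^ 2) = chiSquared (Module.finrank ℝ E) := by
  rw [stdGaussian, Measure.map_map (by fun_prop) (by fun_prop), chiSquared]
  congr 1
  ext x
  have h := (stdOrthonormalBasis ℝ E).sum_sq_norm_inner_right (∑ i, x i • stdOrthonormalBasis ℝ E i)
  rw [Function.comp_apply, ← h]
  refine Finset.sum_congr rfl fun i _ => ?_
  rw [(stdOrthonormalBasis ℝ E).orthonormal.inner_right_fintype, Real.norm_eq_abs, sq_abs]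

lemma stdGaussian_map_inner (u : E) :
    (stdGaussian E).map (fun x => inner ℝ x u) = (gaussianReal 0 1).map (fun y => ‖u‖ * y) := by
  have h := IsGaussian.map_eq_gaussianReal (μ := stdGaussian E) (innerSL ℝ u)
  rw [variance_dual_stdGaussian, integral_strongDual_stdGaussian, innerSL_apply_norm] at h
  have h2 := gaussianReal_map_const_mul (μ := 0) (v := 1) ‖u‖
  rw [h2]
  have : (fun x => inner ℝ x u) = ⇑(innerSL ℝ u) := by
    ext x
    simp [real_inner_comm]
  rw [this, h]
  congr 1
  · simp
  · ext
    simp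

variable {T : E →L[ℝ] E}

lemma map_stdGaussian_map_inner (hT : IsSelfAdjoint T) (v : E) :
    ((stdGaussian E).map T).map (fun x => inner ℝ x v) =
      (gaussianReal 0 1).map (fun y => ‖T v‖ * y) := by
  rw [Measure.map_map (by fun_prop) (by fun_prop), ← stdGaussian_map_inner]
  congr 1
  ext x
  exact hT.isSymmetric x v

lemma real_inner_mem (hT : IsSelfAdjoint T) (v : E) {s : Set ℝ} (hs : MeasurableSet s) :
    ((stdGaussian E).map T).real {x | inner ℝ x v ∈ s} =
      (gaussianReal 0 1).real {y | ‖T v‖ * y ∈ s} := by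
  have h := congrArg (fun μ => μ.real s) (map_stdGaussian_map_inner hT v)
  rwa [map_measureReal_apply (by fun_prop) hs, map_measureReal_apply (by fun_prop) hs] at h

lemma lt_real_lt_inner (hT : IsSelfAdjoint T) {q : ℝ} (hq : q < 1) {v : E} {t : ℝ}
    (ht : t < -(quantile (gaussianReal 0 1) q * ‖T v‖)) :
    q < ((stdGaussian E).map T).real {x | t < inner ℝ x v} := by
  have h := real_inner_mem hT v (measurableSet_Ioi (a := t))
  simp only [Set.mem_Ioi] at h
  rw [h]
  rcases (norm_nonneg (T v)).eq_or_lt with h0 | h0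
  · rw [← h0] at ht ⊢
    have : {y : ℝ | t < 0 * y} = Set.univ := by
      ext y
      simp only [zero_mul, Set.mem_ofPred_eq, Set.mem_univ, iff_true]
      linarith
    rw [this]
    simpa using hq
  · have hz : quantile (gaussianReal 0 1) q < -t / ‖T v‖ := by
      rw [lt_div_iff₀ h0]
      linarith
    obtain ⟨y, hy, hyx⟩ := exists_between hz
    rw [lt_div_iff₀ h0] at hyx
    calc q < cdf (gaussianReal 0 1) y := lt_cdf_gaussianReal hq hy
      _ = (gaussianReal 0 1).real (Set.Ici (-y)) := (gaussianReal_real_Ici_neg y).symm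
      _ ≤ _ := measureReal_mono fun w (hw : -y ≤ w) => by
        change t < ‖T v‖ * w
        nlinarith

/-- The condition `T v ≠ 0` is essential: otherwise `inner ℝ x v` vanishes almost surely and the
half-space has full mass. -/
lemma real_le_inner_lt (hT : IsSelfAdjoint T) {q r : ℝ} (hq : 0 < q)
    (hr : r < quantile (gaussianReal 0 1) q) {v : E} (hv : T v ≠ 0) :
    ((stdGaussian E).map T).real {x | -(r * ‖T v‖) ≤ inner ℝ x v} < q := by
  have h := real_inner_mem hT v (measurableSet_Ici (a := -(r * ‖T v‖)))
  simp only [Set.mem_Ici] at h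
  rw [h]
  have h0 := norm_pos_iff.2 hv
  have : {y : ℝ | -(r * ‖T v‖) ≤ ‖T v‖ * y} = Set.Ici (-r) := by
    ext y
    simp only [Set.mem_ofPred_eq, Set.mem_Ici]
    constructor
    · intro h
      exact le_of_mul_le_mul_left (by linarith) h0
    · intro h
      nlinarith
  rw [this, gaussianReal_real_Ici_neg]
  exact cdf_lt_of_lt_quantile hq hr

lemma apply_eq_zero_of_real_inner_eq_zero (hT : IsSelfAdjoint T) {v : E}
    (h : ((stdGaussian E).map T).real {x | inner ℝ x v = 0} ≠ 0) : T v = 0 := by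
  by_contra hv
  apply h
  have h := real_inner_mem hT v (measurableSet_singleton (0 : ℝ))
  simp only [Set.mem_singleton_iff] at h
  rw [h]
  have : {y : ℝ | ‖T v‖ * y = 0} = {0} := by
    ext y
    simp [hv]
  have hn := nullSingletonClass_gaussianReal (μ := 0) (v := 1) one_ne_zero
  rw [this, measureReal_def, measure_singleton]
  rfl

/-- Pulled back along `T`, the ellipsoid bounds the projection of a standard normal vector to the
range of `T`. The dimension of that range, not of `E`, gives the degrees of freedom. -/
lemma real_ellipsoid_le (hT : IsSelfAdjoint T) {r : ℝ} (hr : 0 ≤ r) :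
    ((stdGaussian E).map T).real (ellipsoid T r) ≤
      cdf (chiSquared (Module.finrank ℝ (LinearMap.range (T : E →ₗ[ℝ] E)))) (r ^ 2) := by
  set W := LinearMap.range (T : E →ₗ[ℝ] E)
  rw [map_measureReal_apply (by fun_prop) (isClosed_ellipsoid r).measurableSet, cdf_eq_real,
    ← stdGaussian_map_norm_sq, map_measureReal_apply (by fun_prop) measurableSet_Iic,
    ← stdGaussian_map_orthogonalProjection, map_measureReal_apply (by fun_prop)
      (measurableSet_preimage (by fun_prop) measurableSet_Iic)]
  refine measureReal_mono fun y hy => ?_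
  exact pow_le_pow_left₀ (norm_nonneg _) (norm_orthogonalProjection_le_of_mem_ellipsoid hT hr hy) 2

end Gaussian

/-! ### The square root of the covariance matrix. -/

section SquareRoot

open scoped MatrixOrder

variable {S : ℕ} {M : Matrix (Fin S) (Fin S) ℝ}

/-- The positive square root of a matrix as an operator on Euclidean space. -/
def sqrtCLM (M : Matrix (Fin S) (Fin S) ℝ) : Vec S →L[ℝ] Vec S :=
  Matrix.toEuclideanCLM (𝕜 := ℝ) (CFC.sqrt M)

lemma isSelfAdjoint_sqrtCLM : IsSelfAdjoint (sqrtCLM M) :=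
  (CFC.sqrt_nonneg M).isSelfAdjoint.map _

lemma multivariateGaussian_zero_eq_map :
    multivariateGaussian 0 M = (stdGaussian (Vec S)).map (sqrtCLM M) := by
  simp [multivariateGaussian, sqrtCLM]

lemma finrank_range_sqrtCLM (hM : M.PosSemidef) :
    Module.finrank ℝ (LinearMap.range (sqrtCLM M : Vec S →ₗ[ℝ] Vec S)) = M.rank := by
  have h1 : (CFC.sqrt M).rank = M.rank := by
    have hs : (CFC.sqrt M).conjTranspose = CFC.sqrt M := (CFC.sqrt_nonneg M).isSelfAdjoint
    have := Matrix.rank_conjTranspose_mul_self (CFC.sqrt M)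
    rw [hs, CFC.sqrt_mul_sqrt_self _ hM.nonneg] at this
    exact this.symm
  rw [← h1, Matrix.rank_eq_finrank_range_toLin (CFC.sqrt M)
    (EuclideanSpace.basisFun (Fin S) ℝ).toBasis
    (EuclideanSpace.basisFun (Fin S) ℝ).toBasis]
  congr 2

end SquareRoot

/-! ### Portmanteau bounds for closed and open sets. -/

section Portmanteau

variable {E Ω : Type*} [TopologicalSpace E] [MeasurableSpace E] [OpensMeasurableSpace E]
  [HasOuterApproxClosed E] [MeasurableSpace Ω] {X : ℕ → Ω → E} {μ : ℕ → Measure Ω}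
  [∀ N, IsProbabilityMeasure (μ N)] {ν : Measure E} [IsProbabilityMeasure ν]

lemma eventually_real_lt_of_isClosed (h : TendstoInDistribution X atTop id μ ν) {F : Set E}
    (hF : IsClosed F) {q : ℝ} (hq : ν.real F < q) :
    ∀ᶠ N in atTop, (μ N).real {ω | X N ω ∈ F} < q := by
  have hl := ProbabilityMeasure.limsup_measure_closed_le_of_tendsto h.tendsto hF
  simp only [ProbabilityMeasure.coe_mk, Measure.map_id] at hl
  have hlt : ν F < ENNReal.ofReal q := by
    rwa [← ENNReal.ofReal_toReal (measure_ne_top ν F),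
      ENNReal.ofReal_lt_ofReal_iff_of_nonneg ENNReal.toReal_nonneg]
  filter_upwards [eventually_lt_of_limsup_lt (hl.trans_lt hlt)] with N hN
  rw [Measure.map_apply_of_aemeasurable (h.forall_aemeasurable N) hF.measurableSet] at hN
  exact (ENNReal.lt_ofReal_iff_toReal_lt (measure_ne_top _ _)).1 hN

lemma eventually_lt_real_of_isOpen (h : TendstoInDistribution X atTop id μ ν) {G : Set E}
    (hG : IsOpen G) {q : ℝ} (hq : q < ν.real G) :
    ∀ᶠ N in atTop, q < (μ N).real {ω | X N ω ∈ G} := by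
  have hc : ν.real Gᶜ < 1 - q := by
    rw [probReal_compl_eq_one_sub hG.measurableSet]
    linarith
  filter_upwards [eventually_real_lt_of_isClosed h hG.isClosed_compl hc] with N hN
  have := probReal_compl_eq_one_sub₀ (μ := μ N)
    ((h.forall_aemeasurable N).nullMeasurable hG.measurableSet)
  rw [← Set.preimage_compl] at this
  have h2 : (μ N).real (X N ⁻¹' Gᶜ) < 1 - q := hN
  have h3 : q < (μ N).real (X N ⁻¹' G) := by linarith
  exact h3

end Portmanteau

/-! ### Painlevé–Kuratowski limits. -/

section SetLimits

variable {E : Type*} [TopologicalSpace E] {C : ℕ → Set E}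

lemma innerLim_subset_outerLim : innerLim C ⊆ outerLim C := fun _ hx U hU =>
  (hx U hU).frequently

lemma isClosed_outerLim : IsClosed (outerLim C) := by
  refine isClosed_of_closure_subset fun x hx U hU => ?_
  obtain ⟨V, hVU, hV, hxV⟩ := mem_nhds_iff.1 hU
  obtain ⟨y, hyV, hy⟩ := mem_closure_iff.1 hx V hV hxV
  exact (hy V (hV.mem_nhds hyV)).mono fun N h => h.mono (Set.inter_subset_inter_right _ hVU)

lemma outerLim_subset_of_eventually_subset {F : Set E} (hF : IsClosed F)
    (h : ∀ᶠ N in atTop, C N ⊆ F) : outerLim C ⊆ F := by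
  intro x hx
  by_contra hxF
  obtain ⟨N, ⟨y, hyC, hyF⟩, hN⟩ := ((hx Fᶜ (hF.isOpen_compl.mem_nhds hxF)).and_eventually h).exists
  exact hyF (hN hyC)

/-- Each point of `K` has a neighbourhood that `C N` eventually misses; finitely many of them cover
`K`. -/
lemma eventually_disjoint_of_isCompact {K : Set E} (hK : IsCompact K)
    (h : Disjoint K (outerLim C)) : ∀ᶠ N in atTop, Disjoint (C N) K := by
  refine hK.induction_on (p := fun K => ∀ᶠ N in atTop, Disjoint (C N) K) (by simp)
    (fun s t hst ht => ht.mono fun N hN => hN.mono_right hst)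
    (fun s t hs ht => (hs.and ht).mono fun N hN => Set.disjoint_union_right.2 hN) fun x hx => ?_
  have hx' : ¬ ∀ U ∈ 𝓝 x, ∃ᶠ N in atTop, (C N ∩ U).Nonempty := Set.disjoint_left.1 h hx
  push Not at hx'
  obtain ⟨U, hU, hd⟩ := hx'
  refine ⟨U, mem_nhdsWithin_of_mem_nhds hU, ?_⟩
  filter_upwards [hd] with N hN
  exact Set.disjoint_iff_inter_eq_empty.2 hN

end SetLimits

/-! ### Mass of the outer limit. -/

section LimitOfRegions

variable {E Ω : Type*} [NormedAddCommGroup E] [ProperSpace E] [MeasurableSpace E]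
  [BorelSpace E] [MeasurableSpace Ω] {X : ℕ → Ω → E} {μ : ℕ → Measure Ω}
  [∀ N, IsProbabilityMeasure (μ N)] {ν : Measure E} [IsProbabilityMeasure ν]

/-- Probability mass does not escape from the outer limit of sets. -/
lemma le_real_outerLim (h : TendstoInDistribution X atTop id μ ν) {C : ℕ → Set E} {q : ℝ}
    (hC : ∀ N, q ≤ (μ N).real {ω | X N ω ∈ C N}) : q ≤ ν.real (outerLim C) := by
  by_contra! hlt
  set K := outerLim C
  -- These closed sets decrease to `K`. The part far from the origin is included because `C N` is
  -- forced close to `K` only on bounded sets.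
  set F : ℕ → Set E := fun n => Metric.cthickening (1 / ((n : ℝ) + 1)) K ∪ {x | (n : ℝ) ≤ ‖x‖}
  have hFc : ∀ n, IsClosed (F n) := fun n =>
    Metric.isClosed_cthickening.union (isClosed_le continuous_const continuous_norm)
  have hanti : Antitone F := fun m n hmn => by
    have hmn' : (m : ℝ) ≤ n := by exact_mod_cast hmn
    refine Set.union_subset_union (Metric.cthickening_mono (by gcongr) K) fun x hx => ?_
    exact hmn'.trans hx
  have hKc : IsClosed K := isClosed_outerLim
  have hinter : (⋂ n, F n) ⊆ K := by
    intro x hx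
    rw [← hKc.closure_eq, Metric.closure_eq_iInter_cthickening]
    simp only [Set.mem_iInter] at hx ⊢
    intro δ hδ
    obtain ⟨n, hn⟩ := exists_nat_gt (max ‖x‖ (1 / δ))
    rcases hx n with h1 | h1
    · refine Metric.cthickening_mono ?_ K h1
      rw [one_div_le (by positivity) hδ]
      linarith [le_max_right ‖x‖ (1 / δ)]
    · exact absurd (le_max_left ‖x‖ (1 / δ)) (not_le.2 (hn.trans_le h1))
  obtain ⟨n, hn⟩ := exists_measureReal_lt_of_iInter (fun n => (hFc n).measurableSet) hanti
    ((measureReal_mono hinter).trans_lt hlt)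
  have hcomp : IsCompact (Metric.closedBall (0 : E) n \ Metric.thickening (1 / ((n : ℝ) + 1)) K) :=
    (isCompact_closedBall 0 _).diff Metric.isOpen_thickening
  have hdisj : Disjoint (Metric.closedBall (0 : E) n \ Metric.thickening (1 / ((n : ℝ) + 1)) K) K :=
    Set.disjoint_sdiff_left.mono_right (Metric.self_subset_thickening (by positivity) K)
  obtain ⟨N, hN, hd⟩ := ((eventually_real_lt_of_isClosed h (hFc n) hn).and
    (eventually_disjoint_of_isCompact hcomp hdisj)).exists
  have hsub : C N ⊆ F n := by
    intro x hx
    have hx' := Set.disjoint_left.1 hd hx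
    by_cases hxn : (n : ℝ) ≤ ‖x‖
    · exact Or.inr hxn
    · refine Or.inl (Metric.thickening_subset_cthickening _ _ ?_)
      by_contra hxt
      exact hx' ⟨by simpa using (not_le.1 hxn).le, hxt⟩
  have hss : {ω | X N ω ∈ C N} ⊆ {ω | X N ω ∈ F n} := fun ω hω => hsub hω
  exact absurd ((hC N).trans (measureReal_mono hss)) (not_le.2 hN)

end LimitOfRegions

/-! ### Uniform bounds over families of half-spaces. -/

section UniformHalfspaces

variable {E Ω : Type*} [NormedAddCommGroup E] [InnerProductSpace ℝ E]
  [MeasurableSpace E] [BorelSpace E] [MeasurableSpace Ω] {X : ℕ → Ω → E} {μ : ℕ → Measure Ω}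
  [∀ N, IsProbabilityMeasure (μ N)] {ν : Measure E} [IsProbabilityMeasure ν] {T : E →L[ℝ] E}

/-- Half-spaces with small mass in the limit have small mass along the sequence, uniformly over
compact sets of normal vectors. -/
lemma eventually_forall_real_le_inner_lt (h : TendstoInDistribution X atTop id μ ν)
    {r q : ℝ} (hr : 0 ≤ r) {K : Set E} (hK : IsCompact K)
    (hlt : ∀ v ∈ K, ν.real {x | -(r * ‖T v‖) ≤ inner ℝ x v} < q) :
    ∀ᶠ N in atTop, ∀ v ∈ K, (μ N).real {ω | -(r * ‖T v‖) ≤ inner ℝ (X N ω) v} < q := by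
  refine hK.induction_on (p := fun K => ∀ᶠ N in atTop, ∀ v ∈ K,
      (μ N).real {ω | -(r * ‖T v‖) ≤ inner ℝ (X N ω) v} < q) (by simp)
    (fun s t hst ht => ht.mono fun N hN v hv => hN v (hst hv))
    (fun s t hs ht => (hs.and ht).mono fun N hN v hv => hv.elim (hN.1 v) (hN.2 v)) fun v hv => ?_
  -- One closed set containing the half-spaces of all normals `w` near `v`: changing `v` to `w`
  -- costs at most `‖w - v‖ * (‖x‖ + r * ‖T‖)`.
  set F : ℕ → Set E := fun n =>
    {x | 0 ≤ inner ℝ x v + r * ‖T v‖ + 1 / ((n : ℝ) + 1) * (‖x‖ + r * ‖T‖)} with hF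
  have hFc : ∀ n, IsClosed (F n) := fun n => isClosed_le (by fun_prop) (by fun_prop)
  have hanti : Antitone F := fun m n hmn x hx => by
    simp only [hF, Set.mem_ofPred_eq] at hx ⊢
    refine hx.trans ?_
    have hmn' : (m : ℝ) ≤ n := by exact_mod_cast hmn
    gcongr
  have hinter : (⋂ n, F n) ⊆ {x | -(r * ‖T v‖) ≤ inner ℝ x v} := by
    intro x hx
    simp only [hF, Set.mem_iInter, Set.mem_ofPred_eq] at hx
    have ht : Tendsto (fun n : ℕ => inner ℝ x v + r * ‖T v‖ + 1 / ((n : ℝ) + 1) * (‖x‖ + r * ‖T‖))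
        atTop (𝓝 (inner ℝ x v + r * ‖T v‖ + 0 * (‖x‖ + r * ‖T‖))) :=
      (tendsto_one_div_add_atTop_nhds_zero_nat.mul_const _).const_add _
    have := ge_of_tendsto' ht hx
    simp only [Set.mem_ofPred_eq]
    linarith
  obtain ⟨n, hn⟩ := exists_measureReal_lt_of_iInter (fun n => (hFc n).measurableSet) hanti
    ((measureReal_mono hinter).trans_lt (hlt v hv))
  refine ⟨Metric.ball v (1 / ((n : ℝ) + 1)), mem_nhdsWithin_of_mem_nhds
    (Metric.ball_mem_nhds v (by positivity)), ?_⟩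
  filter_upwards [eventually_real_lt_of_isClosed h (hFc n) hn] with N hN w hw
  have hss : {ω | -(r * ‖T w‖) ≤ inner ℝ (X N ω) w} ⊆ {ω | X N ω ∈ F n} := by
    intro ω hω
    simp only [hF, Set.mem_ofPred_eq] at hω ⊢
    have hwv : ‖w - v‖ ≤ 1 / ((n : ℝ) + 1) := by
      rw [← dist_eq_norm]
      exact (Metric.mem_ball.1 hw).le
    have h1 : inner ℝ (X N ω) w ≤ inner ℝ (X N ω) v + ‖X N ω‖ * ‖w - v‖ := by
      have := real_inner_le_norm (X N ω) (w - v)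
      rw [inner_sub_right] at this
      linarith
    have h2 : ‖T w‖ ≤ ‖T v‖ + ‖T‖ * ‖w - v‖ := by
      have h3 := T.le_opNorm (w - v)
      have h4 := norm_sub_norm_le (T w) (T v)
      rw [map_sub] at h3
      linarith
    have h3 : (‖X N ω‖ + r * ‖T‖) * ‖w - v‖ ≤ (‖X N ω‖ + r * ‖T‖) * (1 / ((n : ℝ) + 1)) := by
      gcongr
    have h4 := mul_le_mul_of_nonneg_left h2 hr
    linarith
  exact (measureReal_mono hss).trans_lt hN

end UniformHalfspaces

/-! ### Bounds for the value at risk. -/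

section ValueAtRisk

variable {Ω : Type*} [MeasurableSpace Ω] {μ : Measure Ω} {α : ℝ}
  {X : Ω → ℝ} {b t : ℝ}

/-- The almost sure bound `b` makes the set bounded above; a real `sSup` of an unbounded set would
be `0`. -/
lemma le_valueAtRisk (hα : α < 1) (hb : ∀ᵐ ω ∂μ, X ω ≤ b)
    (ht : 1 - α ≤ μ.real {ω | t ≤ X ω}) : t ≤ valueAtRisk μ α X := by
  refine le_csSup ⟨b, fun y hy => ?_⟩ ht
  by_contra! hby
  have h0 : μ {ω | y ≤ X ω} = 0 := by
    refine measure_mono_null (fun ω hω => ?_) (ae_iff.1 hb)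
    simp only [Set.mem_ofPred_eq, not_le] at hω ⊢
    linarith
  simp only [Set.mem_ofPred_eq, measureReal_def, h0] at hy
  simp only [ENNReal.toReal_zero] at hy
  linarith

variable [IsProbabilityMeasure μ]

lemma real_eq_one_of_ae {p : Ω → Prop} (h : ∀ᵐ ω ∂μ, p ω) : μ.real {ω | p ω} = 1 := by
  rw [measureReal_congr (t := Set.univ) (by filter_upwards [h] with ω hω; exact eq_true hω)]
  simp

lemma le_valueAtRisk_of_ae_le (hα0 : 0 ≤ α) (hα : α < 1) (hb : ∀ᵐ ω ∂μ, X ω ≤ b)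
    (ht : ∀ᵐ ω ∂μ, t ≤ X ω) : t ≤ valueAtRisk μ α X :=
  le_valueAtRisk hα hb (by rw [real_eq_one_of_ae ht]; linarith)

lemma valueAtRisk_le (hα0 : 0 ≤ α) (hb : ∀ᵐ ω ∂μ, b ≤ X ω)
    (h : ∀ s, 1 - α ≤ μ.real {ω | s ≤ X ω} → s ≤ t) : valueAtRisk μ α X ≤ t :=
  csSup_le ⟨b, by simp only [Set.mem_ofPred_eq]; rw [real_eq_one_of_ae hb]; linarith⟩ h

end ValueAtRisk

/-! ### The simplex and the VaR constraints. -/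

section Simplex

variable {S A : ℕ}

/-- The vector all of whose coordinates are `1`. -/
def ones (S : ℕ) : Vec S := WithLp.toLp 2 fun _ => 1

lemma inner_ones (p : Vec S) : inner ℝ p (ones S) = ∑ i, p i := by
  simp [ones, PiLp.inner_apply]

lemma inner_ones_of_mem_simplex {p : Vec S} (hp : p ∈ simplex S) : inner ℝ p (ones S) = 1 := by
  rw [inner_ones]
  exact hp.2

lemma abs_inner_le_of_mem_simplex {p : Vec S} (hp : p ∈ simplex S) (v : Vec S) :
    |inner ℝ p v| ≤ ∑ i, |v i| := by
  rw [PiLp.inner_apply]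
  refine (Finset.abs_sum_le_sum_abs _ _).trans (Finset.sum_le_sum fun i _ => ?_)
  have h1 : p i ≤ 1 := by
    rw [← hp.2]
    exact Finset.single_le_sum (fun j _ => hp.1 j) (Finset.mem_univ i)
  simp only [RCLike.inner_apply, conj_trivial, abs_mul, abs_of_nonneg (hp.1 i)]
  exact mul_le_of_le_one_right (abs_nonneg _) h1

variable {μ : Measure (Model S A)} [IsProbabilityMeasure μ] {α : ℝ} {s : Fin S} {a : Fin A}

/-- Membership in the simplex is implied by the other constraints of the VaR ambiguity set. -/
lemma mem_varSet_iff (hα : α ∈ Set.Ico (0 : ℝ) 1) (hμ : ∀ᵐ P ∂μ, P s a ∈ simplex S) {p : Vec S} :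
    p ∈ varSet μ α s a ↔
      ∀ v, valueAtRisk μ α (fun P => inner ℝ (P s a) v) ≤ inner ℝ p v := by
  refine ⟨fun h v => (Set.mem_iInter.1 h v).2, fun h => Set.mem_iInter.2 fun v => ⟨?_, h v⟩⟩
  -- A linear inequality valid on the simplex holds almost surely for `P s a`, so it bounds the VaR
  -- and passes to `p`. Such inequalities cut out the simplex.
  have key : ∀ (w : Vec S) (t : ℝ), (∀ x ∈ simplex S, t ≤ inner ℝ x w) → t ≤ inner ℝ p w := by
    intro w t hw
    refine le_trans (le_valueAtRisk_of_ae_le hα.1 hα.2 (b := ∑ i, |w i|) ?_ ?_) (h w)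
    · filter_upwards [hμ] with P hP
      exact (le_abs_self _).trans (abs_inner_le_of_mem_simplex hP w)
    · filter_upwards [hμ] with P hP
      exact hw _ hP
  refine ⟨fun i => ?_, le_antisymm ?_ ?_⟩
  · have := key (EuclideanSpace.single i 1) 0 fun x hx => by
      simpa [EuclideanSpace.inner_single_right] using hx.1 i
    simpa [EuclideanSpace.inner_single_right] using this
  · have := key (-ones S) (-1) fun x hx => by
      rw [inner_neg_right, inner_ones_of_mem_simplex hx]
    rw [inner_neg_right, inner_ones] at this
    linarith
  · have := key (ones S) 1 fun x hx => (inner_ones_of_mem_simplex hx).ge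
    rwa [inner_ones] at this

end Simplex

/-! ### Limits of VaR sets and of credible regions. -/

section VarLimit

variable {S A : ℕ} {post : ℕ → Measure (Model S A)} [∀ N, IsProbabilityMeasure (post N)]
  {α : ℝ} {s : Fin S} {a : Fin A} {p : Vec S} {M : Matrix (Fin S) (Fin S) ℝ}

lemma eventually_le_inner_of_mem_scaled (hα : α ∈ Set.Ioo (0 : ℝ) 1)
    (hpost : ∀ N, ∀ᵐ P ∂(post N), P s a ∈ simplex S)
    (h : TendstoInDistribution (fun (N : ℕ) (P : Model S A) => √(N : ℝ) • (P s a - p)) atTop id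
      post (multivariateGaussian 0 M))
    {v : Vec S} {t : ℝ} (ht : t < -(quantile (gaussianReal 0 1) (1 - α) * ‖sqrtCLM M v‖)) :
    ∀ᶠ N in atTop, ∀ y ∈ scaled 1 (fun N => varSet (post N) α s a) p N, t ≤ inner ℝ y v := by
  have hG : IsOpen {x : Vec S | t < inner ℝ x v} := isOpen_lt (by fun_prop) (by fun_prop)
  have hq := lt_real_lt_inner (isSelfAdjoint_sqrtCLM (M := M)) (by linarith [hα.1]) ht
  rw [← multivariateGaussian_zero_eq_map] at hq
  filter_upwards [eventually_lt_real_of_isOpen h hG hq, eventually_gt_atTop 0] with N hN hN0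
  rintro _ ⟨p', hp', rfl⟩
  have hs : 0 < √(N : ℝ) := Real.sqrt_pos.2 (by exact_mod_cast hN0)
  rw [mem_varSet_iff ⟨hα.1.le, hα.2⟩ (hpost N)] at hp'
  have hle : t / √(N : ℝ) + inner ℝ p v ≤ inner ℝ p' v := by
    refine le_trans (le_valueAtRisk (b := ∑ i, |v i|) hα.2 ?_ ?_) (hp' v)
    · filter_upwards [hpost N] with P hP
      exact (le_abs_self _).trans (abs_inner_le_of_mem_simplex hP v)
    · refine hN.le.trans (measureReal_mono fun P hP => ?_)
      simp only [Set.mem_ofPred_eq, real_inner_smul_left, inner_sub_left] at hP ⊢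
      have : t / √(N : ℝ) < inner ℝ (P s a) v - inner ℝ p v := (div_lt_iff₀' hs).2 hP
      linarith
  have : t / √(N : ℝ) ≤ inner ℝ p' v - inner ℝ p v := by linarith
  rw [mul_one, real_inner_smul_left, inner_sub_left]
  exact (div_le_iff₀' hs).1 this

/-- The scaled deviations lie in the closed hyperplane orthogonal to `ones S`, hence so does the
Gaussian limit almost surely. -/
lemma sqrtCLM_ones (hpost : ∀ N, ∀ᵐ P ∂(post N), P s a ∈ simplex S) (hp : p ∈ simplex S)
    (h : TendstoInDistribution (fun (N : ℕ) (P : Model S A) => √(N : ℝ) • (P s a - p)) atTop id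
      post (multivariateGaussian 0 M)) : sqrtCLM M (ones S) = 0 := by
  refine apply_eq_zero_of_real_inner_eq_zero isSelfAdjoint_sqrtCLM fun h0 => ?_
  rw [← multivariateGaussian_zero_eq_map] at h0
  have hF : IsClosed {x : Vec S | inner ℝ x (ones S) = 0} :=
    isClosed_eq (by fun_prop) (by fun_prop)
  obtain ⟨N, hN⟩ := (eventually_real_lt_of_isClosed h hF (h0.trans_lt one_pos)).exists
  refine hN.ne (real_eq_one_of_ae ?_)
  filter_upwards [hpost N] with P hP
  rw [real_inner_smul_left, inner_sub_left, inner_ones_of_mem_simplex hP,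
    inner_ones_of_mem_simplex hp, sub_self, mul_zero]

lemma ones_ne_zero (hS : 0 < S) : ones S ≠ 0 := fun h => by
  have := congrArg (fun v : Vec S => v ⟨0, hS⟩) h
  simp [ones] at this

/-- Rank `S - 1` leaves a one-dimensional kernel, which `ones S` spans. -/
lemma sqrtCLM_ne_zero (hS : 0 < S) (hM : M.PosSemidef) (hrank : M.rank = S - 1)
    (hones : sqrtCLM M (ones S) = 0) {v : Vec S} (hv : inner ℝ v (ones S) = 0) (hv0 : v ≠ 0) :
    sqrtCLM M v ≠ 0 := by
  intro h
  set T : Vec S →ₗ[ℝ] Vec S := (sqrtCLM M : Vec S →ₗ[ℝ] Vec S)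
  have hdim := T.finrank_range_add_finrank_ker
  rw [finrank_range_sqrtCLM hM, hrank, finrank_euclideanSpace_fin] at hdim
  have hker : Module.finrank ℝ (LinearMap.ker T) = 1 := by omega
  have h1 : ones S ∈ LinearMap.ker T := hones
  obtain ⟨c, hc⟩ := (finrank_eq_one_iff_of_nonzero' (⟨ones S, h1⟩ : LinearMap.ker T)
    (fun h0 => ones_ne_zero hS (congrArg Subtype.val h0))).1 hker ⟨v, h⟩
  have hc' : c • ones S = v := congrArg Subtype.val hc
  rw [← hc', real_inner_smul_left, mul_eq_zero, inner_self_eq_zero] at hv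
  rcases hv with hv | hv
  · exact hv0 (by rw [← hc', hv, zero_smul])
  · exact ones_ne_zero hS hv

/-- Shrinking by `l < 1` puts the limiting half-space masses strictly below `1 - α`. Compactness of
the unit normals orthogonal to `ones S` then gives one `N` for all constraints. -/
lemma eventually_smul_mem_scaled (hα : α ∈ Set.Ioo (0 : ℝ) (1 / 2)) (hS : 0 < S)
    (hpost : ∀ N, ∀ᵐ P ∂(post N), P s a ∈ simplex S) (hp : p ∈ simplex S)
    (hM : M.PosSemidef) (hrank : M.rank = S - 1)
    (h : TendstoInDistribution (fun (N : ℕ) (P : Model S A) => √(N : ℝ) • (P s a - p)) atTop id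
      post (multivariateGaussian 0 M))
    {x : Vec S} (hx : x ∈ ellipsoid (sqrtCLM M) (quantile (gaussianReal 0 1) (1 - α)))
    {l : ℝ} (hl : l ∈ Set.Ico (0 : ℝ) 1) :
    ∀ᶠ N in atTop, l • x ∈ scaled 1 (fun N => varSet (post N) α s a) p N := by
  have hα1 := hα.1
  have hα2 := hα.2
  set T := sqrtCLM M with hT
  set z := quantile (gaussianReal 0 1) (1 - α)
  have hz : 0 < z := quantile_gaussianReal_pos hα
  have hones := sqrtCLM_ones hpost hp h
  have hK : IsCompact (Metric.sphere (0 : Vec S) 1 ∩ {v | inner ℝ v (ones S) = 0}) :=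
    (isCompact_sphere 0 1).inter_right (isClosed_eq (by fun_prop) (by fun_prop))
  have hunif := eventually_forall_real_le_inner_lt (T := T) (q := 1 - α) h
    (mul_nonneg hl.1 hz.le) hK fun v hv => by
      rw [multivariateGaussian_zero_eq_map]
      refine real_le_inner_lt isSelfAdjoint_sqrtCLM (by linarith) (mul_lt_of_lt_one_left hz hl.2)
        (sqrtCLM_ne_zero hS hM hrank hones hv.2 fun h0 => ?_)
      simp [h0] at hv
  filter_upwards [hunif, eventually_gt_atTop 0] with N hN hN0
  have hs : 0 < √(N : ℝ) := Real.sqrt_pos.2 (by exact_mod_cast hN0)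
  refine ⟨p + (l / √(N : ℝ)) • x, ?_, ?_⟩
  swap
  · simp only [mul_one, add_sub_cancel_left, smul_smul]
    rw [mul_div_cancel₀ _ hs.ne']
  rw [mem_varSet_iff ⟨hα1.le, by linarith⟩ (hpost N)]
  intro v
  refine valueAtRisk_le hα1.le (b := -∑ i, |v i|) ?_ fun t ht => ?_
  · filter_upwards [hpost N] with P hP
    exact (abs_le.1 (abs_inner_le_of_mem_simplex hP v)).1
  by_contra! hlt
  rw [inner_add_left, real_inner_smul_left] at hlt
  -- The component of `v` along `ones S` is irrelevant: `T` kills it, and `P s a` and `p` pair with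
  -- it equally.
  set c : ℝ := inner ℝ v (ones S) / inner ℝ (ones S) (ones S) with hc
  set v' := v - c • ones S with hv'
  have hone : inner ℝ (ones S) (ones S) ≠ 0 := fun h0 =>
    ones_ne_zero hS (inner_self_eq_zero.1 h0)
  have hv'1 : inner ℝ v' (ones S) = 0 := by
    rw [hv', inner_sub_left, real_inner_smul_left, hc, div_mul_cancel₀ _ hone, sub_self]
  have hTv : T v' = T v := by
    rw [hv', map_sub, map_smul, hones, smul_zero, sub_zero]
  have hsub : ∀ᵐ P ∂(post N), t ≤ inner ℝ (P s a) v →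
      -(l * z * ‖T v'‖) < inner ℝ (√(N : ℝ) • (P s a - p)) v' := by
    filter_upwards [hpost N] with P hP htP
    have h1 : inner ℝ (P s a - p) (ones S) = 0 := by
      rw [inner_sub_left, inner_ones_of_mem_simplex hP, inner_ones_of_mem_simplex hp, sub_self]
    have h2 : inner ℝ (P s a - p) v' = inner ℝ (P s a) v - inner ℝ p v := by
      rw [hv', inner_sub_right, inner_smul_right, h1, mul_zero, sub_zero, inner_sub_left]
    rw [real_inner_smul_left, h2, hTv]
    have h3 : l / √(N : ℝ) * inner ℝ x v < inner ℝ (P s a) v - inner ℝ p v := by linarith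
    rw [div_mul_eq_mul_div, div_lt_iff₀' hs] at h3
    have h4 := mul_le_mul_of_nonneg_left (hx v) hl.1
    linarith
  rcases eq_or_ne v' 0 with h0 | h0
  -- For `v` a multiple of `ones S`, `hsub` says `0 < 0` on the event, which is therefore null.
  · have hnull : (post N) {P | t ≤ inner ℝ (P s a) v} = 0 := by
      refine measure_eq_zero_iff_ae_notMem.2 ?_
      filter_upwards [hsub] with P hP htP
      have := hP htP
      simp [h0] at this
    rw [measureReal_def, hnull, ENNReal.toReal_zero] at ht
    linarith
  · have hn : 0 < ‖v'‖ := norm_pos_iff.2 h0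
    have hN' := hN (‖v'‖⁻¹ • v') ⟨by simp [norm_smul, hn.ne'], by
      simp only [Set.mem_ofPred_eq]
      rw [real_inner_smul_left, hv'1, mul_zero]⟩
    refine absurd (ht.trans (ENNReal.toReal_mono (measure_ne_top _ _) (measure_mono_ae ?_)))
      (not_le.2 hN')
    filter_upwards [hsub] with P hP htP
    have h5 := mul_le_mul_of_nonneg_left (hP htP).le (inv_nonneg.2 hn.le)
    change -(l * z * ‖T (‖v'‖⁻¹ • v')‖) ≤ inner ℝ (√(N : ℝ) • (P s a - p)) (‖v'‖⁻¹ • v')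
    rw [map_smul, norm_smul, inner_smul_right, norm_inv, norm_norm]
    linarith

lemma mem_scaled_iff {C : ℕ → Set (Vec S)} {ξ : ℝ} {N : ℕ} {x : Vec S} :
    x ∈ scaled ξ C p N ↔ ∃ y ∈ scaled 1 C p N, ξ • y = x := by
  constructor
  · rintro ⟨y, hy, rfl⟩
    refine ⟨_, ⟨y, hy, rfl⟩, ?_⟩
    simp only [mul_one, smul_smul, mul_comm ξ]
  · rintro ⟨_, ⟨y, hy, rfl⟩, rfl⟩
    refine ⟨y, hy, ?_⟩
    simp only [mul_one, smul_smul, mul_comm ξ]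

/-- The scaled VaR ambiguity sets converge to ellipsoids. -/
lemma setTendsto_scaled_varSet (hα : α ∈ Set.Ioo (0 : ℝ) (1 / 2)) (hS : 0 < S)
    (hpost : ∀ N, ∀ᵐ P ∂(post N), P s a ∈ simplex S) (hp : p ∈ simplex S)
    (hM : M.PosSemidef) (hrank : M.rank = S - 1)
    (h : TendstoInDistribution (fun (N : ℕ) (P : Model S A) => √(N : ℝ) • (P s a - p)) atTop id
      post (multivariateGaussian 0 M)) (ξ : ℝ) :
    SetTendsto (scaled ξ (fun N => varSet (post N) α s a) p)
      (ellipsoid (sqrtCLM M) (|ξ| * quantile (gaussianReal 0 1) (1 - α))) := by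
  set z := quantile (gaussianReal 0 1) (1 - α) with hzdef
  have hz : 0 < z := quantile_gaussianReal_pos hα
  have hout : outerLim (scaled ξ (fun N => varSet (post N) α s a) p) ⊆
      ellipsoid (sqrtCLM M) (|ξ| * z) := by
    intro x hx v
    refine le_of_forall_lt fun t ht => ?_
    obtain ⟨t', htt', ht'⟩ := exists_between ht
    refine htt'.trans_le (outerLim_subset_of_eventually_subset (F := {y | t' ≤ inner ℝ y v})
      (isClosed_le (by fun_prop) (by fun_prop)) ?_ hx)
    -- The factor `ξ` is moved onto `v`, which reduces all `ξ`, including negative ones, to the case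
    -- `ξ = 1`.
    have ht'' : t' < -(z * ‖sqrtCLM M (ξ • v)‖) := by
      rw [map_smul, norm_smul, Real.norm_eq_abs]
      linarith
    filter_upwards [eventually_le_inner_of_mem_scaled ⟨hα.1, by linarith [hα.2]⟩ hpost h ht'']
      with N hN y hy
    obtain ⟨w, hw, rfl⟩ := mem_scaled_iff.1 hy
    have := hN w hw
    rw [inner_smul_right] at this
    simpa only [Set.mem_ofPred_eq, real_inner_smul_left] using this
  have hin : ellipsoid (sqrtCLM M) (|ξ| * z) ⊆
      innerLim (scaled ξ (fun N => varSet (post N) α s a) p) := by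
    intro x hx U hU
    obtain ⟨y, hy, rfl⟩ := exists_smul_eq_of_mem_ellipsoid hz.le hx
    have hcont : Tendsto (fun l : ℝ => ξ • l • y) (𝓝[<] 1) (𝓝 (ξ • y)) := by
      have : Continuous fun l : ℝ => ξ • l • y := by fun_prop
      simpa using (this.tendsto 1).mono_left nhdsWithin_le_nhds
    obtain ⟨l, hlU, hl⟩ := ((hcont.eventually_mem hU).and (Ico_mem_nhdsLT one_pos)).exists
    filter_upwards [eventually_smul_mem_scaled hα hS hpost hp hM hrank h hy hl] with N hN
    exact ⟨ξ • l • y, mem_scaled_iff.2 ⟨_, hN, rfl⟩, hlU⟩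
  exact ⟨(innerLim_subset_outerLim.trans hout).antisymm hin,
    hout.antisymm (hin.trans innerLim_subset_outerLim)⟩

/-- The outer limit of the scaled credible regions is in no ellipsoid that is too small. -/
lemma not_outerLim_subset_ellipsoid (hα : α ∈ Set.Ioo (0 : ℝ) (1 / 2))
    (hM : M.PosSemidef) (hrank : M.rank = S - 1)
    (h : TendstoInDistribution (fun (N : ℕ) (P : Model S A) => √(N : ℝ) • (P s a - p)) atTop id
      post (multivariateGaussian 0 M)) {C : ℕ → Set (Vec S)}
    (hC : ∀ N, IsCredibleRegion (post N) α s a (C N)) {ξ : ℝ} (hξ : |ξ| < radiusRatio S α) :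
    ¬ outerLim (scaled 1 C p) ⊆
      ellipsoid (sqrtCLM M) (|ξ| * quantile (gaussianReal 0 1) (1 - α)) := by
  intro hsub
  set z := quantile (gaussianReal 0 1) (1 - α) with hzdef
  have hz : 0 < z := quantile_gaussianReal_pos hα
  have hmass : 1 - α ≤ (multivariateGaussian 0 M).real (outerLim (scaled 1 C p)) := by
    refine le_real_outerLim h fun N => (hC N).2.trans (measureReal_mono fun P hP => ?_)
    exact ⟨P s a, hP, by simp⟩
  rw [radiusRatio, ← hzdef, lt_div_iff₀ hz] at hξ
  have hlt : (|ξ| * z) ^ 2 < quantile (chiSquared (S - 1)) (1 - α) :=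
    (Real.lt_sqrt (by positivity)).1 hξ
  have hle := real_ellipsoid_le (isSelfAdjoint_sqrtCLM (M := M)) (r := |ξ| * z) (by positivity)
  rw [finrank_range_sqrtCLM hM, hrank, ← multivariateGaussian_zero_eq_map] at hle
  have hcdf := cdf_lt_of_lt_quantile (by linarith [hα.2]) hlt
  linarith [measureReal_mono (μ := multivariateGaussian 0 M) hsub]

end VarLimit

end CredibleRadius

end

/-! ### The main theorem. -/

open CredibleRadius in
theorem theorem4p3 (α : ℝ) (hα : α ∈ Set.Ioo (0 : ℝ) (1 / 2)) :
    ∃ c c' : ℝ, 0 < c ∧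
      -- the ratio grows like `√S`
      (∀ S : ℕ, 2 ≤ S → c * √(S : ℝ) ≤ radiusRatio S α ∧ radiusRatio S α ≤ c' * √(S : ℝ)) ∧
      ∀ (S A : ℕ), 2 ≤ S →
      ∀ (post : ℕ → Measure (Model S A)) [∀ N, IsProbabilityMeasure (post N)]
        (pstar : Model S A) (cov : Fin S → Fin A → Matrix (Fin S) (Fin S) ℝ),
        (∀ N, ∀ᵐ P ∂(post N), ∀ s a, P s a ∈ simplex S) →
        (∀ s a, pstar s a ∈ simplex S) →
        AsymptoticallyNormal post pstar cov →
        ∀ (s : Fin S) (a : Fin A),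
          -- `V ξ` is the limit of `√N ξ (P^VaR_{s,a} - p*_{s,a})`
          ∃ V : ℝ → Set (Vec S),
            (∀ ξ : ℝ, SetTendsto (scaled ξ (fun N => varSet (post N) α s a) (pstar s a)) (V ξ)) ∧
            ∀ C : ℕ → Set (Vec S), (∀ N, IsCredibleRegion (post N) α s a (C N)) →
              (∀ ξ : ℝ, |ξ| < radiusRatio S α →
                ¬ outerLim (scaled 1 C (pstar s a)) ⊆ V ξ ∧
                ∀ L : Set (Vec S), SetTendsto (scaled 1 C (pstar s a)) L → ¬ L ⊆ V ξ) ∧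
              -- in some direction `u` the limit of the credible regions reaches at least
              -- `c √S` times as far as the limit of the VaR ambiguity sets
              ∃ u : Vec S, u ≠ 0 ∧ ∃ t : ℝ, 0 < t ∧
                t • u ∈ outerLim (scaled 1 C (pstar s a)) ∧
                ∀ r : ℝ, 0 ≤ r → r • u ∈ V 1 → c * √(S : ℝ) * r < t := by
  obtain ⟨c, c', hc, hcc⟩ := exists_radiusRatio_bounds hα
  refine ⟨c, c', hc, fun S hS => ⟨(hcc S hS).1.le, (hcc S hS).2⟩, ?_⟩
  intro S A hS post _ pstar cov hpost hpstar hnormal s a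
  obtain ⟨hM, hrank, hlim⟩ := hnormal s a
  have hpost' : ∀ N, ∀ᵐ P ∂(post N), P s a ∈ simplex S := fun N =>
    (hpost N).mono fun P hP => hP s a
  set z := quantile (gaussianReal 0 1) (1 - α)
  have hz : 0 < z := quantile_gaussianReal_pos hα
  refine ⟨fun ξ => ellipsoid (sqrtCLM (cov s a)) (|ξ| * z),
    setTendsto_scaled_varSet hα (by omega) hpost' (hpstar s a) hM hrank hlim, fun C hC => ?_⟩
  refine ⟨fun ξ hξ => ⟨not_outerLim_subset_ellipsoid hα hM hrank hlim hC hξ, fun L hL => ?_⟩, ?_⟩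
  · rw [← hL.2]
    exact not_outerLim_subset_ellipsoid hα hM hrank hlim hC hξ
  have hcS : 0 < c * √(S : ℝ) :=
    mul_pos hc (Real.sqrt_pos.2 (by exact_mod_cast (by omega : 0 < S)))
  -- The strict bound `c * √S < radiusRatio S α` allows `ξ = c * √S`; any point of the outer limit
  -- outside that ellipsoid is a suitable direction, with `t = 1`.
  have hnot := not_outerLim_subset_ellipsoid hα hM hrank hlim hC (ξ := c * √(S : ℝ))
    (by rw [abs_of_pos hcS]; exact (hcc S hS).1)
  obtain ⟨x, hx, hxV⟩ := Set.not_subset.1 hnot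
  refine ⟨x, fun h0 => hxV ?_, 1, one_pos, by rwa [one_smul], fun r hr hrx => ?_⟩
  · rw [h0]
    exact zero_mem_ellipsoid (by positivity)
  by_contra! hle
  have hr0 : 0 < r := by
    rcases hr.eq_or_lt with h | h
    · rw [← h] at hle
      linarith
    · exact h
  apply hxV
  -- If `r • x` were in `V 1` with `1 ≤ c * √S * r`, then `x` would be in the ellipsoid of radius `z
  -- / r ≤ c * √S * z`.
  have h1 := smul_mem_ellipsoid hrx r⁻¹
  rw [inv_smul_smul₀ hr0.ne'] at h1
  refine ellipsoid_mono ?_ h1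
  rw [abs_one, one_mul, abs_of_pos hcS, abs_of_pos (inv_pos.2 hr0)]
  gcongr
  rwa [inv_le_iff_one_le_mul₀ hr0]
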